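/- Let $H$ be a complex separable Hilbert space. For a bounded operator $X$ on $H$ and $0<r<\infty$ put $|X|=(X^*X)^{1/2}$ and $\|X\|_r=(\operatorname{tr}|X|^r)^{1/r}\in[0,\infty]$, where $\operatorname{tr}$ is the usual trace of positive operators, and let $B_r(H)=\{X : \|X\|_r<\infty\}$ be the Schatten $r$-class. Let $n$ be a natural number, let $1<p\le 2$ and $\frac1p+\frac1q=1$. If $$\Big\|\sum_{i=1}^n x_i\Big\|_p^q+\sum_{1\le i<j\le n}\|x_i-x_j\|_p^q\le n\Big(\sum_{i=1}^n\|x_i\|_p^p\Big)^{q/p}\quad\text{for all } x_1,\dots,x_n\in B_p(H),$$ then $$n\Big(\sum_{i=1}^n\|\varphi_i\|_q^q\Big)^{p/q}\le\Big\|\sum_{i=1}^n\varphi_i\Big\|_q^p+\sum_{1\le i<j\le n}\|\varphi_i-\varphi_j\|_q^p\quad\text{for all }\varphi_1,\dots,\varphi_n\in B_q(H).$$ -/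

import Mathlib

open scoped ENNReal InnerProductSpace

noncomputable section

/-- The sum of the diagonal entries `⟨e i, T (e i)⟩` of a positive operator `T` in the Hilbert
basis `e`, as an element of `[0, ∞]`. -/
def diagSum {H : Type*} [NormedAddCommGroup H] [InnerProductSpace ℂ H] {ι : Type*}
    (e : HilbertBasis ι ℂ H) (T : H →L[ℂ] H) : ℝ≥0∞ :=
  ∑' i, ENNReal.ofReal (⟪e i, T (e i)⟫_ℂ).re

/-- The trace of a positive bounded operator, as an element of `[0, ∞]`. It is computed in some
Hilbert basis of `H`; by `posTrace_eq_diagSum` below every Hilbert basis gives the same value. -/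
def posTrace {H : Type*} [NormedAddCommGroup H] [InnerProductSpace ℂ H] [CompleteSpace H]
    (T : H →L[ℂ] H) : ℝ≥0∞ :=
  diagSum (exists_hilbertBasis ℂ H).choose_spec.choose T

/-- The Schatten `p`-norm `‖X‖_p = (tr |X|^p)^(1/p)` for `0 < p < ∞`, as an element of `[0, ∞]`.
Here `|X| = (X* X)^(1/2)` and its real powers are those of the continuous functional calculus. The
value is `∞` when `X` is not compact. -/
def schattenNorm {H : Type*} [NormedAddCommGroup H] [InnerProductSpace ℂ H] [CompleteSpace H]
    (p : ℝ) (X : H →L[ℂ] H) : ℝ≥0∞ :=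
  posTrace (CFC.abs X ^ p) ^ (1 / p)

/-- The Schatten class `B_p(H)`: the bounded operators of finite Schatten `p`-norm. -/
def schattenClass (H : Type*) [NormedAddCommGroup H] [InnerProductSpace ℂ H] [CompleteSpace H]
    (p : ℝ) : Set (H →L[ℂ] H) :=
  {X | schattenNorm p X < ∞}

/-- Parseval's identity in `[0, ∞]`. -/
theorem tsum_ofReal_inner_sq {H : Type*} [NormedAddCommGroup H] [InnerProductSpace ℂ H]
    {ι : Type*} (e : HilbertBasis ι ℂ H) (x : H) :
    ∑' i, ENNReal.ofReal (‖⟪e i, x⟫_ℂ‖ ^ 2) = ENNReal.ofReal (‖x‖ ^ 2) := by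
  have h := Complex.hasSum_re (e.hasSum_inner_mul_inner x x)
  have h1 : ∀ i, (⟪x, e i⟫_ℂ * ⟪e i, x⟫_ℂ).re = ‖⟪e i, x⟫_ℂ‖ ^ 2 := fun i => by
    rw [← inner_conj_symm x (e i), Complex.conj_mul']
    norm_cast
  have h2 : (⟪x, x⟫_ℂ).re = ‖x‖ ^ 2 := by
    rw [inner_self_eq_norm_sq_to_K]
    norm_cast
  simp only [h1, h2] at h
  rw [← h.tsum_eq, ENNReal.ofReal_tsum_of_nonneg (fun i => by positivity) h.summable]

theorem diagSum_star_mul_self {H : Type*} [NormedAddCommGroup H] [InnerProductSpace ℂ H]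
    [CompleteSpace H] {ι κ : Type*} (e : HilbertBasis ι ℂ H) (f : HilbertBasis κ ℂ H)
    (S : H →L[ℂ] H) :
    diagSum e (star S * S)
      = ∑' j, ENNReal.ofReal (‖ContinuousLinearMap.adjoint S (f j)‖ ^ 2) := by
  have h1 : diagSum e (star S * S) = ∑' i, ENNReal.ofReal (‖S (e i)‖ ^ 2) := by
    refine tsum_congr fun i => ?_
    have : (⟪e i, (star S * S) (e i)⟫_ℂ).re = ‖S (e i)‖ ^ 2 := by
      rw [mul_apply_eq_comp, ContinuousLinearMap.star_eq_adjoint,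
        ContinuousLinearMap.adjoint_inner_right, inner_self_eq_norm_sq_to_K]
      norm_cast
    rw [this]
  have h2 : ∀ i, ENNReal.ofReal (‖S (e i)‖ ^ 2)
      = ∑' j, ENNReal.ofReal (‖⟪f j, S (e i)⟫_ℂ‖ ^ 2) :=
    fun i => (tsum_ofReal_inner_sq f _).symm
  rw [h1, tsum_congr h2, ENNReal.tsum_comm]
  refine tsum_congr fun j => ?_
  rw [← tsum_ofReal_inner_sq e]
  refine tsum_congr fun i => ?_
  rw [ContinuousLinearMap.adjoint_inner_right, norm_inner_symm]

/-- The diagonal sum of a positive operator does not depend on the Hilbert basis. -/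
theorem diagSum_eq_diagSum {H : Type*} [NormedAddCommGroup H] [InnerProductSpace ℂ H]
    [CompleteSpace H] {ι κ : Type*} (e : HilbertBasis ι ℂ H) (f : HilbertBasis κ ℂ H)
    {T : H →L[ℂ] H} (hT : 0 ≤ T) : diagSum e T = diagSum f T := by
  obtain ⟨S, rfl⟩ := CStarAlgebra.nonneg_iff_eq_star_mul_self.mp hT
  rw [diagSum_star_mul_self e e, diagSum_star_mul_self f e]

/-- The trace of a positive operator can be computed in any Hilbert basis. -/
theorem posTrace_eq_diagSum {H : Type*} [NormedAddCommGroup H] [InnerProductSpace ℂ H]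
    [CompleteSpace H] {ι : Type*} (e : HilbertBasis ι ℂ H) {T : H →L[ℂ] H} (hT : 0 ≤ T) :
    posTrace T = diagSum e T :=
  diagSum_eq_diagSum _ e hT

end

/-!
The matrix `M` taking a family to its sum and its differences `xᵢ - xⱼ`, `i < j`, satisfies
`Mᴴ M = n`, so `n ∑ᵢ tr (xᵢ* φᵢ) = ∑ₖ tr ((M x)ₖ* (M φ)ₖ)`. For `xᵢ = φᵢ |φᵢ|^(q - 2)` the left side
is `n ∑ᵢ ‖φᵢ‖_q^q = n ∑ᵢ ‖xᵢ‖_p^p`. On the right, Hölder's inequality for the Schatten norms and for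
the sum over `k`, followed by the hypothesis on `x`, leaves the asserted bound after cancellation.

Hölder's inequality for the Schatten norms comes from an orthonormal basis of eigenvectors of `|X|`,
on which the values of `X` are orthogonal with norms the singular values of `X`. Compared in the
bases of `X` and of `Y`, the singular values of `Y` are averaged by a doubly substochastic matrix,
to which Jensen's inequality applies when the exponent of `Y` is at least `2`; one of the two
conjugate exponents always is.
-/

section ENNReal

theorem ennreal_tsum_mul_le_Lp_mul_Lq {ι : Type*} {p q : ℝ} (hpq : p.HolderConjugate q)
    (f g : ι → ℝ≥0∞) :
    ∑' i, f i * g i ≤ (∑' i, f i ^ p) ^ (1 / p) * (∑' i, g i ^ q) ^ (1 / q) := by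
  rw [ENNReal.tsum_eq_iSup_sum]
  refine iSup_le fun s => (ENNReal.inner_le_Lp_mul_Lq s f g hpq).trans ?_
  have := hpq.pos
  have := hpq.symm.pos
  gcongr <;> exact ENNReal.sum_le_tsum s

theorem ennreal_tsum_mul_rpow_le_tsum_mul_rpow {ι : Type*} {s : ℝ} (hs : 1 ≤ s)
    (w f : ι → ℝ≥0∞) (hw : ∑' i, w i ≤ 1) : (∑' i, w i * f i) ^ s ≤ ∑' i, w i * f i ^ s := by
  have hs0 : 0 < s := zero_lt_one.trans_le hs
  have hs1 : 0 ≤ 1 - s⁻¹ := sub_nonneg.mpr (inv_le_one_of_one_le₀ hs)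
  rw [← ENNReal.le_rpow_inv_iff hs0, ENNReal.tsum_eq_iSup_sum]
  refine iSup_le fun t => ?_
  calc ∑ i ∈ t, w i * f i
      ≤ (∑ i ∈ t, w i) ^ (1 - s⁻¹) * (∑ i ∈ t, w i * f i ^ s) ^ s⁻¹ :=
        ENNReal.inner_le_weight_mul_Lp_of_nonneg t hs w f
    _ ≤ 1 * (∑' i, w i * f i ^ s) ^ s⁻¹ := by
        gcongr
        · exact ENNReal.rpow_le_one ((ENNReal.sum_le_tsum t).trans hw) hs1
        · exact ENNReal.sum_le_tsum t
    _ = (∑' i, w i * f i ^ s) ^ s⁻¹ := one_mul _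

theorem ennreal_tsum_tsum_mul_rpow_le {ι κ : Type*} {s : ℝ} (hs : 1 ≤ s)
    (w : κ → ι → ℝ≥0∞) (f : ι → ℝ≥0∞) (hrow : ∀ j, ∑' i, w j i ≤ 1) (hcol : ∀ i, ∑' j, w j i ≤ 1) :
    ∑' j, (∑' i, w j i * f i) ^ s ≤ ∑' i, f i ^ s :=
  calc ∑' j, (∑' i, w j i * f i) ^ s
      ≤ ∑' j, ∑' i, w j i * f i ^ s := ENNReal.tsum_le_tsum fun j =>
        ennreal_tsum_mul_rpow_le_tsum_mul_rpow hs (w j) f (hrow j)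
    _ = ∑' i, (∑' j, w j i) * f i ^ s := by
        rw [ENNReal.tsum_comm]
        exact tsum_congr fun i => ENNReal.tsum_mul_right
    _ ≤ ∑' i, f i ^ s := ENNReal.tsum_le_tsum fun i => mul_le_of_le_one_left zero_le (hcol i)

theorem ennreal_eq_rpow_mul_rpow {p q : ℝ} (hpq : p.HolderConjugate q) (a : ℝ≥0∞) :
    a = a ^ (1 / q) * a ^ (1 / p) := by
  rw [← ENNReal.rpow_add_of_nonneg _ _ hpq.symm.one_div_nonneg hpq.one_div_nonneg, add_comm,
    hpq.one_div_add_one_div, div_one, ENNReal.rpow_one]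

theorem ennreal_mul_rpow_le_of_mul_le_rpow_mul_rpow {p q : ℝ} (hpq : p.HolderConjugate q)
    {a b r : ℝ≥0∞} (ha : a ≠ ∞) (hb : b ≠ ∞)
    (h : a * b ≤ (a * b ^ (q / p)) ^ (1 / q) * r ^ (1 / p)) : a * b ^ (p / q) ≤ r := by
  have hp := hpq.pos
  have hq := hpq.symm.pos
  rcases eq_or_ne a 0 with rfl | ha0
  · simp
  rcases eq_or_ne b 0 with rfl | hb0
  · simp [div_pos hp hq]
  set d := a ^ (1 / q) * b ^ (1 / p) with hd
  have hd0 : d ≠ 0 := by simp [hd, ENNReal.rpow_eq_zero_iff, ha, hb, ha0, hb0]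
  have hdtop : d ≠ ∞ := ENNReal.mul_ne_top (ENNReal.rpow_ne_top_of_nonneg (by positivity) ha)
    (ENNReal.rpow_ne_top_of_nonneg (by positivity) hb)
  have hlhs : a * b = d * (a * b ^ (p / q)) ^ (1 / p) := by
    rw [hd, ENNReal.mul_rpow_of_nonneg _ _ (by positivity), ← ENNReal.rpow_mul,
      show p / q * (1 / p) = 1 / q by field_simp]
    nth_rw 1 [ennreal_eq_rpow_mul_rpow hpq a, ennreal_eq_rpow_mul_rpow hpq b]
    ring
  have hrhs : (a * b ^ (q / p)) ^ (1 / q) = d := by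
    rw [hd, ENNReal.mul_rpow_of_nonneg _ _ (by positivity), ← ENNReal.rpow_mul,
      show q / p * (1 / q) = 1 / p by field_simp]
  rw [hlhs, hrhs, ENNReal.mul_le_mul_iff_right hd0 hdtop] at h
  exact (ENNReal.rpow_le_rpow_iff (by positivity)).mp h

end ENNReal

section InnerProductSpace

variable {𝕜 : Type*} [RCLike 𝕜] {E : Type*} [NormedAddCommGroup E] [InnerProductSpace 𝕜 E]

theorem enorm_inner_symm (x y : E) : ‖⟪x, y⟫_𝕜‖ₑ = ‖⟪y, x⟫_𝕜‖ₑ := by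
  rw [← ofReal_norm, norm_inner_symm, ofReal_norm]

theorem tsum_enorm_inner_sq_le_of_orthonormal {ι : Type*} {v : ι → E} (hv : Orthonormal 𝕜 v)
    (x : E) : ∑' i, ‖⟪v i, x⟫_𝕜‖ₑ ^ 2 ≤ ‖x‖ₑ ^ 2 := by
  have h := ENNReal.ofReal_le_ofReal (hv.tsum_inner_products_le x)
  rw [ENNReal.ofReal_tsum_of_nonneg (fun i => by positivity) (hv.inner_products_summable x)] at h
  simpa only [ENNReal.ofReal_pow (norm_nonneg _), ofReal_norm] using h

section Normalize

open NormedSpace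

variable [NormedSpace ℝ E]

theorem enorm_normalize_le_one (x : E) : ‖normalize x‖ₑ ≤ 1 := by
  rcases eq_or_ne x 0 with rfl | hx
  · simp
  · rw [← ofReal_norm, norm_normalize_eq_one_iff.mpr hx, ENNReal.ofReal_one]

variable [IsScalarTower ℝ 𝕜 E]

theorem enorm_mul_enorm_inner_normalize (y x : E) :
    ‖y‖ₑ * ‖⟪normalize y, x⟫_𝕜‖ₑ = ‖⟪y, x⟫_𝕜‖ₑ := by
  conv_rhs => rw [← norm_smul_normalize y, inner_smul_left_eq_smul, enorm_smul, enorm_norm]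

theorem orthonormal_normalize {ι : Type*} {g : ι → E}
    (hg : Pairwise fun i j => ⟪g i, g j⟫_𝕜 = 0) :
    Orthonormal 𝕜 fun i : {i // g i ≠ 0} => normalize (g i) := by
  refine ⟨fun i => norm_normalize_eq_one_iff.mpr i.2, fun i j hij => ?_⟩
  simp only [NormedSpace.normalize, inner_smul_left_eq_smul, inner_smul_right_eq_smul,
    hg (Subtype.coe_ne_coe.mpr hij), smul_zero]

theorem tsum_enorm_inner_normalize_sq_le {ι : Type*} {g : ι → E}
    (hg : Pairwise fun i j => ⟪g i, g j⟫_𝕜 = 0) (x : E) :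
    ∑' i, ‖⟪normalize (g i), x⟫_𝕜‖ₑ ^ 2 ≤ ‖x‖ₑ ^ 2 := by
  have hsupp : Function.support (fun i => ‖⟪normalize (g i), x⟫_𝕜‖ₑ ^ 2) ⊆ {i | g i ≠ 0} :=
    fun i hi h => hi (by simp [h])
  rw [← tsum_subtype_eq_of_support_subset hsupp]
  exact tsum_enorm_inner_sq_le_of_orthonormal (orthonormal_normalize hg) x

theorem tsum_enorm_inner_normalize_normalize_sq_le_one {κ : Type*} {g : κ → E}
    (hg : Pairwise fun i j => ⟪g i, g j⟫_𝕜 = 0) (x : E) :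
    ∑' j, ‖⟪normalize (g j), normalize x⟫_𝕜‖ₑ ^ 2 ≤ 1 :=
  (tsum_enorm_inner_normalize_sq_le hg _).trans (pow_le_one₀ zero_le (enorm_normalize_le_one x))

end Normalize

theorem tsum_enorm_inner_sq {ι : Type*} (e : HilbertBasis ι 𝕜 E) (x : E) :
    ∑' i, ‖⟪e i, x⟫_𝕜‖ₑ ^ 2 = ‖x‖ₑ ^ 2 := by
  have h := RCLike.hasSum_re 𝕜 (e.hasSum_inner_mul_inner x x)
  simp only [inner_mul_symm_re_eq_norm, norm_mul, norm_inner_symm x, ← sq, inner_self_eq_norm_sq]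
    at h
  have hsum := ENNReal.ofReal_tsum_of_nonneg (fun i => by positivity) h.summable
  rw [h.tsum_eq] at hsum
  simpa only [ENNReal.ofReal_pow (norm_nonneg _), ofReal_norm] using hsum.symm

theorem tsum_enorm_inner_mul_enorm_inner_le {ι : Type*} (e : HilbertBasis ι 𝕜 E) (x y : E) :
    ∑' i, ‖⟪x, e i⟫_𝕜‖ₑ * ‖⟪y, e i⟫_𝕜‖ₑ ≤ ‖x‖ₑ * ‖y‖ₑ := by
  have hroot : ∀ z : E, (∑' i, ‖⟪z, e i⟫_𝕜‖ₑ ^ (2 : ℝ)) ^ (1 / 2 : ℝ) = ‖z‖ₑ := fun z => by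
    simp only [ENNReal.rpow_two, enorm_inner_symm z]
    rw [tsum_enorm_inner_sq e, ← ENNReal.rpow_two, one_div, ENNReal.rpow_rpow_inv two_ne_zero]
  exact (ennreal_tsum_mul_le_Lp_mul_Lq Real.HolderConjugate.two_two _ _).trans_eq
    (by rw [hroot, hroot])

end InnerProductSpace

section Compact

variable {𝕜 : Type*} [RCLike 𝕜] {E : Type*} [NormedAddCommGroup E] [InnerProductSpace 𝕜 E]
  {F : Type*} [NormedAddCommGroup F] [NormedSpace 𝕜 F]

theorem enorm_sub_sum_smulRight_le {ι : Type*} (e : HilbertBasis ι 𝕜 E) (T : E →L[𝕜] F)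
    (s : Finset ι) :
    ‖T - ∑ i ∈ s, (innerSL 𝕜 (e i)).smulRight (T (e i))‖ₑ
      ≤ (∑' i : {i // i ∉ s}, ‖T (e i)‖ₑ ^ 2) ^ (1 / 2 : ℝ) := by
  refine ContinuousLinearMap.opENorm_le_bound _ fun x => ?_
  have htail : HasSum (fun i : {i // i ∉ s} => ⟪e i, x⟫_𝕜 • T (e i))
      ((T - ∑ i ∈ s, (innerSL 𝕜 (e i)).smulRight (T (e i))) x) := by
    rw [s.hasSum_compl_iff (f := fun i => ⟪e i, x⟫_𝕜 • T (e i))]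
    simpa [e.repr_apply_apply] using T.hasSum (e.hasSum_repr x)
  have hbessel : ∑' i : {i // i ∉ s}, ‖⟪e i, x⟫_𝕜‖ₑ ^ 2 ≤ ‖x‖ₑ ^ 2 :=
    tsum_enorm_inner_sq_le_of_orthonormal
      (e.orthonormal.comp (fun i : {i // i ∉ s} => (i : ι)) Subtype.val_injective) x
  calc ‖(T - ∑ i ∈ s, (innerSL 𝕜 (e i)).smulRight (T (e i))) x‖ₑ
      ≤ ∑' i : {i // i ∉ s}, ‖T (e i)‖ₑ * ‖⟪e i, x⟫_𝕜‖ₑ := by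
        rw [← htail.tsum_eq]
        refine enorm_tsum_le_tsum_enorm.trans_eq (tsum_congr fun i => ?_)
        rw [enorm_smul, mul_comm]
    _ ≤ (∑' i : {i // i ∉ s}, ‖T (e i)‖ₑ ^ 2) ^ (1 / 2 : ℝ)
          * (∑' i : {i // i ∉ s}, ‖⟪e i, x⟫_𝕜‖ₑ ^ 2) ^ (1 / 2 : ℝ) := by
        simpa only [ENNReal.rpow_two] using
          ennreal_tsum_mul_le_Lp_mul_Lq Real.HolderConjugate.two_two
            (fun i : {i // i ∉ s} => ‖T (e i)‖ₑ) fun i => ‖⟪e i, x⟫_𝕜‖ₑ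
    _ ≤ (∑' i : {i // i ∉ s}, ‖T (e i)‖ₑ ^ 2) ^ (1 / 2 : ℝ) * ‖x‖ₑ := by
        gcongr
        rwa [one_div, ENNReal.rpow_inv_le_iff two_pos, ENNReal.rpow_two]

theorem isCompactOperator_of_tsum_enorm_sq_ne_top [CompleteSpace F] {ι : Type*}
    (e : HilbertBasis ι 𝕜 E) (T : E →L[𝕜] F) (hT : ∑' i, ‖T (e i)‖ₑ ^ 2 ≠ ∞) :
    IsCompactOperator T := by
  let S : Finset ι → (E →L[𝕜] F) := fun s => ∑ i ∈ s, (innerSL 𝕜 (e i)).smulRight (T (e i))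
  have hS : ∀ s, IsCompactOperator (S s) := fun s =>
    (compactOperator (RingHom.id 𝕜) E F).sum_mem fun i _ =>
      (isCompactOperator_id.comp_clm (innerSL 𝕜 (e i))).clm_comp
        ((ContinuousLinearMap.id 𝕜 𝕜).smulRight (T (e i)))
  have htail : Filter.Tendsto
      (fun s : Finset ι => (∑' i : {i // i ∉ s}, ‖T (e i)‖ₑ ^ 2) ^ (1 / 2 : ℝ))
      Filter.atTop (nhds 0) := by
    have h := (ENNReal.tendsto_tsum_compl_atTop_zero hT).ennrpow_const (1 / 2 : ℝ)
    rwa [ENNReal.zero_rpow_of_pos one_half_pos] at h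
  have hlim : Filter.Tendsto S Filter.atTop (nhds T) := by
    rw [tendsto_iff_edist_tendsto_0]
    refine tendsto_of_tendsto_of_tendsto_of_le_of_le tendsto_const_nhds htail
      (fun _ => zero_le) fun s => ?_
    rw [edist_comm, edist_eq_enorm_sub]
    exact enorm_sub_sum_smulRight_le e T s
  exact isCompactOperator_of_tendsto hlim (.of_forall hS)

end Compact

section Spectral

variable {𝕜 : Type*} [RCLike 𝕜] {E : Type*} [NormedAddCommGroup E] [InnerProductSpace 𝕜 E]
  [CompleteSpace E]

theorem exists_hilbertBasis_forall_mem {α : Type*} {V : α → Submodule 𝕜 E}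
    [∀ a, CompleteSpace (V a)] (hV : OrthogonalFamily 𝕜 (fun a => V a) fun a => (V a).subtypeₗᵢ)
    (hdense : (⨆ a, V a)ᗮ = ⊥) :
    ∃ (w : Set E) (f : HilbertBasis w 𝕜 E), ∀ i, ∃ a, f i ∈ V a := by
  choose w b _ using fun a => exists_hilbertBasis 𝕜 (V a)
  let v : (Σ a, w a) → E := fun i => (b i.1 i.2 : V i.1)
  have hv : Orthonormal 𝕜 v := hV.orthonormal_sigma_orthonormal fun a => (b a).orthonormal
  have hperp : (Submodule.span 𝕜 (Set.range v))ᗮ = ⊥ := by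
    refine eq_bot_mono (fun x hx => ?_) hdense
    rw [← Submodule.iInf_orthogonal, Submodule.mem_iInf]
    intro a
    have hzero : innerSL 𝕜 x ∘L (V a).subtypeL = 0 := by
      refine ContinuousLinearMap.ext_on (s := Set.range (b a)) ?_ ?_
      · rw [Submodule.dense_iff_topologicalClosure_eq_top]
        exact (b a).dense_span
      · rintro _ ⟨i, rfl⟩
        exact (Submodule.mem_orthogonal' _ _).mp hx _ (Submodule.subset_span ⟨⟨a, i⟩, rfl⟩)
    exact (Submodule.mem_orthogonal' _ _).mpr fun y hy => DFunLike.congr_fun hzero ⟨y, hy⟩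
  refine ⟨Set.range v, .mkOfOrthogonalEqBot hv.toSubtypeRange (by rwa [Subtype.range_coe]), ?_⟩
  rintro ⟨_, i, rfl⟩
  exact ⟨i.1, by simp [v]⟩

theorem exists_hilbertBasis_apply_eq_smul {T : E →L[𝕜] E} (hT : T.IsSymmetric)
    (hc : IsCompactOperator T) :
    ∃ (w : Set E) (f : HilbertBasis w 𝕜 E) (c : w → ℝ), ∀ i, T (f i) = (c i : 𝕜) • f i := by
  have hcomplete (μ : 𝕜) : CompleteSpace (Module.End.eigenspace (T : Module.End 𝕜 E) μ) := by
    have hset : (Module.End.eigenspace (T : Module.End 𝕜 E) μ : Set E) = {x | T x = μ • x} :=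
      Set.ext fun _ => Module.End.mem_eigenspace_iff
    have hclosed := isClosed_eq T.continuous (continuous_const_smul μ)
    rw [← hset] at hclosed
    exact hclosed.completeSpace_coe
  obtain ⟨w, f, hf⟩ := exists_hilbertBasis_forall_mem hT.orthogonalFamily_eigenspaces
    (ContinuousLinearMap.orthogonalComplement_iSup_eigenspaces_eq_bot hc hT)
  choose μ hμ using hf
  refine ⟨w, f, fun i => RCLike.re (μ i), fun i => ?_⟩
  have hreal : ((RCLike.re (μ i) : ℝ) : 𝕜) = μ i := RCLike.conj_eq_iff_re.mp
    (hT.conj_eigenvalue_eq_self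
      (Module.End.hasEigenvalue_of_hasEigenvector ⟨hμ i, f.orthonormal.ne_zero i⟩))
  rw [hreal]
  exact Module.End.mem_eigenspace_iff.mp (hμ i)

end Spectral

section FunctionalCalculus

theorem rpow_add_of_nonneg {A : Type*} [PartialOrder A] [Ring A] [StarRing A]
    [TopologicalSpace A] [StarOrderedRing A] [Algebra ℝ A]
    [ContinuousFunctionalCalculus ℝ A IsSelfAdjoint] [NonnegSpectrumClass ℝ A]
    [IsSemitopologicalRing A] [T2Space A] (T : A) {s t : ℝ} (hs : 0 ≤ s) (ht : 0 ≤ t) :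
    T ^ (s + t) = T ^ s * T ^ t := by
  simp only [CFC.rpow_def]
  rw [← cfc_mul (fun x : NNReal => x ^ s) (fun x : NNReal => x ^ t) T
    (NNReal.continuous_rpow_const hs).continuousOn (NNReal.continuous_rpow_const ht).continuousOn]
  exact cfc_congr fun x _ => NNReal.rpow_add_of_nonneg x hs ht

variable {H : Type*} [NormedAddCommGroup H] [InnerProductSpace ℂ H]

theorem mem_spectrum_of_apply_eq_smul {T : H →L[ℂ] H} {v : H} {c : ℝ} (hv0 : v ≠ 0)
    (hv : T v = (c : ℂ) • v) : c ∈ spectrum ℝ T := by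
  rw [spectrum.mem_iff]
  intro hunit
  have hinj := ((Module.End.isUnit_iff _).mp
    (hunit.map ContinuousLinearMap.toLinearMapRingHom)).injective
  refine hv0 (hinj ?_)
  simp [Algebra.algebraMap_eq_smul_one, hv]

variable [CompleteSpace H]

theorem cfcHom_apply_of_apply_eq_smul {T : H →L[ℂ] H} (hT : IsSelfAdjoint T) {v : H} {c : ℝ}
    (hc : c ∈ spectrum ℝ T) (hv : T v = (c : ℂ) • v) (g : C(spectrum ℝ T, ℝ)) :
    cfcHom hT g v = (g ⟨c, hc⟩ : ℂ) • v := by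
  induction g using ContinuousMap.induction_on_of_compact with
  | const r =>
    have hconst : cfcHom hT (ContinuousMap.const (spectrum ℝ T) r) = algebraMap ℝ (H →L[ℂ] H) r :=
      AlgHomClass.commutes (cfcHom hT) r
    simp [hconst, Algebra.algebraMap_eq_smul_one]
  | id => rw [cfcHom_id hT]; exact hv
  | star_id => rw [map_star, cfcHom_id hT, hT.star_eq]; exact hv
  | add f g hf hg => simp [hf, hg, add_smul]
  | mul f g hf hg =>
    rw [map_mul, mul_apply_eq_comp, hg, map_smul, hf, smul_smul]
    simp [mul_comm]
  | frequently f hf =>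
    have hclosed : IsClosed {g : C(spectrum ℝ T, ℝ) | cfcHom hT g v = (g ⟨c, hc⟩ : ℂ) • v} :=
      isClosed_eq
        ((ContinuousLinearMap.apply ℂ H v).continuous.comp (cfcHom_continuous hT))
        ((Complex.continuous_ofReal.comp (continuous_eval_const _)).smul continuous_const)
    exact hclosed.closure_subset (mem_closure_iff_frequently.mpr hf)

theorem cfc_apply_of_apply_eq_smul {T : H →L[ℂ] H} (hT : IsSelfAdjoint T) {v : H} {c : ℝ}
    (hv : T v = (c : ℂ) • v) (f : ℝ → ℝ) (hf : ContinuousOn f (spectrum ℝ T)) :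
    cfc f T v = (f c : ℂ) • v := by
  rcases eq_or_ne v 0 with rfl | hv0
  · simp
  · rw [cfc_apply f T hT hf,
      cfcHom_apply_of_apply_eq_smul hT (mem_spectrum_of_apply_eq_smul hv0 hv) hv]
    rfl

theorem rpow_apply_of_apply_eq_smul {T : H →L[ℂ] H} (hT : 0 ≤ T) {v : H} {c : ℝ}
    (hv : T v = (c : ℂ) • v) {s : ℝ} (hs : 0 ≤ s) : (T ^ s) v = ((c ^ s : ℝ) : ℂ) • v := by
  rw [CFC.rpow_eq_cfc_real hT]
  exact cfc_apply_of_apply_eq_smul hT.isSelfAdjoint hv _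
    (Real.continuous_rpow_const hs).continuousOn

theorem inner_abs_apply_abs_apply (X : H →L[ℂ] H) (x y : H) :
    ⟪CFC.abs X x, CFC.abs X y⟫_ℂ = ⟪X x, X y⟫_ℂ := by
  calc ⟪CFC.abs X x, CFC.abs X y⟫_ℂ
      = ⟪x, (CFC.abs X * CFC.abs X) y⟫_ℂ := (CFC.abs_nonneg X).isSelfAdjoint.isSymmetric x _
    _ = ⟪x, (star X * X) y⟫_ℂ := by rw [CFC.abs_mul_abs]
    _ = ⟪X x, X y⟫_ℂ := X.adjoint_inner_right x (X y)

theorem enorm_abs_apply (X : H →L[ℂ] H) (x : H) : ‖CFC.abs X x‖ₑ = ‖X x‖ₑ := by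
  rw [← ofReal_norm, ← ofReal_norm, norm_eq_sqrt_re_inner (𝕜 := ℂ), inner_abs_apply_abs_apply,
    ← norm_eq_sqrt_re_inner]

end FunctionalCalculus

section SingularBasis

variable {H : Type*} [NormedAddCommGroup H] [InnerProductSpace ℂ H] [CompleteSpace H]

theorem diagSum_star_mul_self_eq_tsum_enorm_sq {ι : Type*} (e : HilbertBasis ι ℂ H)
    (T : H →L[ℂ] H) : diagSum e (star T * T) = ∑' i, ‖T (e i)‖ₑ ^ 2 := by
  refine tsum_congr fun i => ?_
  rw [mul_apply_eq_comp, ContinuousLinearMap.star_eq_adjoint,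
    ContinuousLinearMap.adjoint_inner_right, ← ofReal_norm, ← ENNReal.ofReal_pow (norm_nonneg _),
    ← inner_self_eq_norm_sq (𝕜 := ℂ)]
  rfl

theorem isCompactOperator_of_posTrace_star_mul_self_ne_top {T : H →L[ℂ] H}
    (hT : posTrace (star T * T) ≠ ∞) : IsCompactOperator T := by
  obtain ⟨w, e, _⟩ := exists_hilbertBasis ℂ H
  rw [posTrace_eq_diagSum e (star_mul_self_nonneg T), diagSum_star_mul_self_eq_tsum_enorm_sq] at hT
  exact isCompactOperator_of_tsum_enorm_sq_ne_top e T hT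

open scoped ComplexOrder in
theorem posTrace_rpow_eq_tsum_enorm_rpow {A : H →L[ℂ] H} (hA : 0 ≤ A) {ι : Type*}
    (f : HilbertBasis ι ℂ H) {c : ι → ℝ} (hc : ∀ i, A (f i) = (c i : ℂ) • f i) {r : ℝ}
    (hr : 0 ≤ r) : posTrace (A ^ r) = ∑' i, ‖A (f i)‖ₑ ^ r := by
  have hinner (b : ℝ) (i : ι) : ⟪f i, (b : ℂ) • f i⟫_ℂ = b := by
    rw [inner_smul_right, inner_self_eq_norm_sq_to_K, f.orthonormal.1 i]
    simp
  have hc0 (i : ι) : 0 ≤ c i := by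
    have h := ((ContinuousLinearMap.nonneg_iff_isPositive A).mp hA).inner_nonneg_right (f i)
    rwa [hc, hinner, Complex.zero_le_real] at h
  rw [posTrace_eq_diagSum f CFC.rpow_nonneg]
  refine tsum_congr fun i => ?_
  rw [rpow_apply_of_apply_eq_smul hA (hc i) hr, hinner, hc, ← ofReal_norm, norm_smul,
    f.orthonormal.1 i, mul_one, Complex.norm_of_nonneg (hc0 i), Complex.ofReal_re,
    ENNReal.ofReal_rpow_of_nonneg (hc0 i) hr]

theorem schattenNorm_rpow_self {r : ℝ} (hr : 0 < r) (X : H →L[ℂ] H) :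
    schattenNorm r X ^ r = posTrace (CFC.abs X ^ r) := by
  rw [schattenNorm, one_div, ENNReal.rpow_inv_rpow hr.ne']

theorem exists_hilbertBasis_abs_apply_eq_smul {r : ℝ} (hr : 0 < r) {X : H →L[ℂ] H}
    (hX : schattenNorm r X ≠ ∞) :
    ∃ (w : Set H) (f : HilbertBasis w ℂ H) (s : w → ℝ), ∀ i, CFC.abs X (f i) = (s i : ℂ) • f i := by
  have hr2 : 0 ≤ r / 2 := by positivity
  set T := CFC.abs X ^ (r / 2)
  have hT : 0 ≤ T := CFC.rpow_nonneg
  have hsq : star T * T = CFC.abs X ^ r := by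
    rw [hT.isSelfAdjoint.star_eq, ← rpow_add_of_nonneg _ hr2 hr2, add_halves]
  have hroot : T ^ (2 / r) = CFC.abs X := by
    rw [CFC.rpow_rpow_of_exponent_nonneg _ _ _ hr2 (by positivity),
      show r / 2 * (2 / r) = 1 by field_simp, CFC.rpow_one _]
  have hcompact : IsCompactOperator T := by
    refine isCompactOperator_of_posTrace_star_mul_self_ne_top ?_
    rw [hsq, ← schattenNorm_rpow_self hr]
    exact ENNReal.rpow_ne_top_of_nonneg hr.le hX
  obtain ⟨w, f, c, hc⟩ := exists_hilbertBasis_apply_eq_smul hT.isSelfAdjoint.isSymmetric hcompact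
  refine ⟨w, f, fun i => c i ^ (2 / r), fun i => ?_⟩
  rw [← hroot]
  exact rpow_apply_of_apply_eq_smul hT (hc i) (by positivity)

theorem exists_hilbertBasis_pairwise_inner_eq_zero {r : ℝ} (hr : 0 < r) {X : H →L[ℂ] H}
    (hX : schattenNorm r X ≠ ∞) :
    ∃ (w : Set H) (f : HilbertBasis w ℂ H), (Pairwise fun i j => ⟪X (f i), X (f j)⟫_ℂ = 0) ∧
      ∑' i, ‖X (f i)‖ₑ ^ r = schattenNorm r X ^ r := by
  obtain ⟨w, f, s, hs⟩ := exists_hilbertBasis_abs_apply_eq_smul hr hX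
  refine ⟨w, f, fun i j hij => ?_, ?_⟩
  · beta_reduce
    rw [← inner_abs_apply_abs_apply, hs, hs, inner_smul_left, inner_smul_right,
      f.orthonormal.2 hij, mul_zero, mul_zero]
  · rw [schattenNorm_rpow_self hr, posTrace_rpow_eq_tsum_enorm_rpow (CFC.abs_nonneg X) f hs hr.le]
    simp only [enorm_abs_apply]

theorem eq_zero_of_schattenNorm_eq_zero {r : ℝ} (hr : 0 < r) {X : H →L[ℂ] H}
    (hX : schattenNorm r X = 0) : X = 0 := by
  obtain ⟨w, f, -, hsum⟩ := exists_hilbertBasis_pairwise_inner_eq_zero hr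
    (hX.trans_ne ENNReal.zero_ne_top)
  rw [hX, ENNReal.zero_rpow_of_pos hr, ENNReal.tsum_eq_zero] at hsum
  have hzero : Set.EqOn X 0 (Set.range f) := by
    rintro _ ⟨i, rfl⟩
    simpa [hr, hr.not_gt] using hsum i
  refine ContinuousLinearMap.ext_on ?_ hzero
  rw [Submodule.dense_iff_topologicalClosure_eq_top]
  exact f.dense_span

end SingularBasis

section Holder

open NormedSpace (normalize)
open ContinuousLinearMap (adjoint)

variable {H : Type*} [NormedAddCommGroup H] [InnerProductSpace ℂ H] [CompleteSpace H]

theorem tsum_enorm_adjoint_normalize_rpow_le {q : ℝ} (hq : 2 ≤ q) (Y : H →L[ℂ] H) {κ : Type*}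
    {g : κ → H} (hg : Pairwise fun i j => ⟪g i, g j⟫_ℂ = 0) :
    ∑' j, ‖adjoint Y (normalize (g j))‖ₑ ^ q ≤ schattenNorm q Y ^ q := by
  have hq0 : 0 < q := two_pos.trans_le hq
  rcases eq_or_ne (schattenNorm q Y) ∞ with htop | hY
  · simp [htop, hq0]
  obtain ⟨w, f, hf, hsum⟩ := exists_hilbertBasis_pairwise_inner_eq_zero hq0 hY
  have hsq (j : κ) : ‖adjoint Y (normalize (g j))‖ₑ ^ 2
      = ∑' l, ‖⟪normalize (Y (f l)), normalize (g j)⟫_ℂ‖ₑ ^ 2 * ‖Y (f l)‖ₑ ^ 2 := by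
    rw [← tsum_enorm_inner_sq f]
    refine tsum_congr fun l => ?_
    rw [ContinuousLinearMap.adjoint_inner_right, ← enorm_mul_enorm_inner_normalize, mul_pow,
      mul_comm]
  have hpow (a : ℝ≥0∞) : (a ^ 2) ^ (q / 2) = a ^ q := by
    rw [← ENNReal.rpow_two, ← ENNReal.rpow_mul, mul_div_cancel₀ q two_ne_zero]
  rw [← hsum]
  simp only [← hpow, hsq]
  refine ennreal_tsum_tsum_mul_rpow_le (by linarith) _ _ (fun j => ?_) fun l => ?_
  · exact tsum_enorm_inner_normalize_normalize_sq_le_one hf _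
  · simp only [enorm_inner_symm (normalize (Y (f l)))]
    exact tsum_enorm_inner_normalize_normalize_sq_le_one hg _

theorem enorm_inner_apply_apply_le_tsum {ι : Type*} (f : HilbertBasis ι ℂ H) (X Y : H →L[ℂ] H)
    (x : H) :
    ‖⟪X x, Y x⟫_ℂ‖ₑ
      ≤ ∑' j, ‖X (f j)‖ₑ * (‖⟪f j, x⟫_ℂ‖ₑ * ‖⟪adjoint Y (normalize (X (f j))), x⟫_ℂ‖ₑ) := by
  rw [← ContinuousLinearMap.adjoint_inner_right, ← f.tsum_inner_mul_inner]
  refine enorm_tsum_le_tsum_enorm.trans_eq (tsum_congr fun j => ?_)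
  rw [enorm_mul, ContinuousLinearMap.adjoint_inner_right, ← enorm_mul_enorm_inner_normalize (X _),
    ContinuousLinearMap.adjoint_inner_left, enorm_inner_symm x]
  ring

theorem tsum_enorm_inner_apply_le_of_two_le {p q : ℝ} (hpq : p.HolderConjugate q) (hq : 2 ≤ q)
    (X Y : H →L[ℂ] H) {κ : Type*} (e : HilbertBasis κ ℂ H) :
    ∑' k, ‖⟪X (e k), Y (e k)⟫_ℂ‖ₑ ≤ schattenNorm p X * schattenNorm q Y := by
  rcases eq_or_ne (schattenNorm q Y) 0 with hY | hY
  · simp [eq_zero_of_schattenNorm_eq_zero hpq.symm.pos hY]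
  rcases eq_or_ne (schattenNorm p X) ∞ with hX | hX
  · simp [hX, ENNReal.top_mul hY]
  obtain ⟨w, f, hf, hsum⟩ := exists_hilbertBasis_pairwise_inner_eq_zero hpq.pos hX
  let v : w → H := fun j => adjoint Y (normalize (X (f j)))
  calc ∑' k, ‖⟪X (e k), Y (e k)⟫_ℂ‖ₑ
      ≤ ∑' k, ∑' j, ‖X (f j)‖ₑ * (‖⟪f j, e k⟫_ℂ‖ₑ * ‖⟪v j, e k⟫_ℂ‖ₑ) :=
        ENNReal.tsum_le_tsum fun k => enorm_inner_apply_apply_le_tsum f X Y (e k)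
    _ = ∑' j, ‖X (f j)‖ₑ * ∑' k, ‖⟪f j, e k⟫_ℂ‖ₑ * ‖⟪v j, e k⟫_ℂ‖ₑ := by
        rw [ENNReal.tsum_comm]
        exact tsum_congr fun j => ENNReal.tsum_mul_left
    _ ≤ ∑' j, ‖X (f j)‖ₑ * ‖v j‖ₑ := by
        gcongr with j
        refine (tsum_enorm_inner_mul_enorm_inner_le e _ _).trans_eq ?_
        rw [← ofReal_norm (f j), f.orthonormal.1 j, ENNReal.ofReal_one, one_mul]
    _ ≤ (∑' j, ‖X (f j)‖ₑ ^ p) ^ (1 / p) * (∑' j, ‖v j‖ₑ ^ q) ^ (1 / q) :=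
        ennreal_tsum_mul_le_Lp_mul_Lq hpq _ _
    _ ≤ (schattenNorm p X ^ p) ^ (1 / p) * (schattenNorm q Y ^ q) ^ (1 / q) := by
        have := hpq.symm.pos
        rw [hsum]
        gcongr
        exact tsum_enorm_adjoint_normalize_rpow_le hq Y hf
    _ = schattenNorm p X * schattenNorm q Y := by
        rw [one_div, one_div, ENNReal.rpow_rpow_inv hpq.ne_zero,
          ENNReal.rpow_rpow_inv hpq.symm.ne_zero]

theorem tsum_enorm_inner_apply_le_schattenNorm_mul {p q : ℝ} (hpq : p.HolderConjugate q)
    (X Y : H →L[ℂ] H) {κ : Type*} (e : HilbertBasis κ ℂ H) :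
    ∑' k, ‖⟪X (e k), Y (e k)⟫_ℂ‖ₑ ≤ schattenNorm p X * schattenNorm q Y := by
  rcases le_total 2 q with hq | hq
  · exact tsum_enorm_inner_apply_le_of_two_le hpq hq X Y e
  · have hp : 2 ≤ p := by
      have := hpq.mul_eq_add
      nlinarith [hpq.lt, hpq.symm.lt]
    simp only [enorm_inner_symm (X _), mul_comm (schattenNorm p X)]
    exact tsum_enorm_inner_apply_le_of_two_le hpq.symm hp Y X e

end Holder

section SchattenDual

variable {H : Type*} [NormedAddCommGroup H] [InnerProductSpace ℂ H] [CompleteSpace H]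

/-- The operator `φ |φ|^(q - 2)`: for `2 ≤ q` and `1 / p + 1 / q = 1` it is the element of
`B_p(H)` that norms `φ ∈ B_q(H)` in the trace duality between the two classes. -/
noncomputable def schattenDual (q : ℝ) (φ : H →L[ℂ] H) : H →L[ℂ] H :=
  φ * CFC.abs φ ^ (q - 2)

theorem star_schattenDual_mul {q : ℝ} (hq : 2 ≤ q) (φ : H →L[ℂ] H) :
    star (schattenDual q φ) * φ = CFC.abs φ ^ q := by
  have hsq : star φ * φ = CFC.abs φ ^ (2 : ℝ) := by
    rw [← CFC.abs_sq φ, ← CFC.rpow_natCast _ 2 (CFC.abs_nonneg φ), Nat.cast_ofNat]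
  have hsa : star (CFC.abs φ ^ (q - 2)) = CFC.abs φ ^ (q - 2) :=
    (CFC.rpow_nonneg (a := CFC.abs φ)).isSelfAdjoint.star_eq
  rw [schattenDual, star_mul, hsa, mul_assoc, hsq,
    ← rpow_add_of_nonneg _ (by linarith) zero_le_two, sub_add_cancel]

theorem abs_schattenDual {q : ℝ} (hq : 2 ≤ q) (φ : H →L[ℂ] H) :
    CFC.abs (schattenDual q φ) = CFC.abs φ ^ (q - 1) := by
  have hsq : star (schattenDual q φ) * schattenDual q φ
      = CFC.abs φ ^ (q - 1) * CFC.abs φ ^ (q - 1) := by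
    nth_rewrite 2 [schattenDual]
    rw [← mul_assoc, star_schattenDual_mul hq, ← rpow_add_of_nonneg _ (by linarith) (by linarith),
      ← rpow_add_of_nonneg _ (by linarith) (by linarith)]
    congr 1
    ring
  rw [CFC.abs, hsq, CFC.sqrt_mul_self _ CFC.rpow_nonneg]

theorem schattenNorm_schattenDual_rpow {p q : ℝ} (hpq : p.HolderConjugate q) (hq : 2 ≤ q)
    (φ : H →L[ℂ] H) : schattenNorm p (schattenDual q φ) ^ p = schattenNorm q φ ^ q := by
  rw [schattenNorm_rpow_self hpq.pos, schattenNorm_rpow_self hpq.symm.pos, abs_schattenDual hq,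
    CFC.rpow_rpow_of_exponent_nonneg _ _ _ (by linarith) hpq.nonneg (CFC.abs_nonneg φ),
    hpq.symm.sub_one_mul_conj]

theorem inner_schattenDual_apply {q : ℝ} (hq : 2 ≤ q) (φ : H →L[ℂ] H) (x : H) :
    ⟪schattenDual q φ x, φ x⟫_ℂ = ⟪x, (CFC.abs φ ^ q) x⟫_ℂ := by
  rw [← star_schattenDual_mul hq, mul_apply_eq_comp, ContinuousLinearMap.star_eq_adjoint,
    ContinuousLinearMap.adjoint_inner_right]

open scoped ComplexOrder in
theorem inner_schattenDual_apply_nonneg {q : ℝ} (hq : 2 ≤ q) (φ : H →L[ℂ] H) (x : H) :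
    0 ≤ ⟪schattenDual q φ x, φ x⟫_ℂ := by
  rw [inner_schattenDual_apply hq]
  exact ((ContinuousLinearMap.nonneg_iff_isPositive _).mp CFC.rpow_nonneg).inner_nonneg_right x

open scoped ComplexOrder in
theorem enorm_eq_ofReal_re_of_nonneg {z : ℂ} (hz : 0 ≤ z) : ‖z‖ₑ = ENNReal.ofReal z.re := by
  rw [← ofReal_norm, Complex.re_eq_norm.mpr hz]

theorem tsum_enorm_inner_schattenDual {q : ℝ} (hq : 2 ≤ q) (φ : H →L[ℂ] H) {κ : Type*}
    (e : HilbertBasis κ ℂ H) :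
    ∑' k, ‖⟪schattenDual q φ (e k), φ (e k)⟫_ℂ‖ₑ = schattenNorm q φ ^ q := by
  rw [schattenNorm_rpow_self (by linarith), posTrace_eq_diagSum e CFC.rpow_nonneg]
  refine tsum_congr fun k => ?_
  rw [enorm_eq_ofReal_re_of_nonneg (inner_schattenDual_apply_nonneg hq φ (e k)),
    inner_schattenDual_apply hq]

end SchattenDual

section Matrix

open scoped Matrix NNReal

theorem sum_inner_sum_smul_sum_smul {𝕜 E ι κ : Type*} [RCLike 𝕜] [NormedAddCommGroup E]
    [InnerProductSpace 𝕜 E] [Fintype ι] [Fintype κ] (M : Matrix κ ι 𝕜) (x y : ι → E) :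
    ∑ k, ⟪∑ i, M k i • x i, ∑ j, M k j • y j⟫_𝕜 = ∑ i, ∑ j, (Mᴴ * M) i j * ⟪x i, y j⟫_𝕜 := by
  calc ∑ k, ⟪∑ i, M k i • x i, ∑ j, M k j • y j⟫_𝕜
      = ∑ k, ∑ i, ∑ j, Mᴴ i k * M k j * ⟪x i, y j⟫_𝕜 := by
        refine Finset.sum_congr rfl fun k _ => ?_
        rw [sum_inner]
        refine Finset.sum_congr rfl fun i _ => ?_
        rw [inner_sum]
        refine Finset.sum_congr rfl fun j _ => ?_
        rw [inner_smul_left, inner_smul_right, mul_assoc]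
        rfl
    _ = ∑ i, ∑ j, ∑ k, Mᴴ i k * M k j * ⟪x i, y j⟫_𝕜 := by
        rw [Finset.sum_comm]
        exact Finset.sum_congr rfl fun i _ => Finset.sum_comm
    _ = ∑ i, ∑ j, (Mᴴ * M) i j * ⟪x i, y j⟫_𝕜 := by
        simp only [Matrix.mul_apply, Finset.sum_mul]

variable {H : Type*} [NormedAddCommGroup H] [InnerProductSpace ℂ H]

theorem mul_enorm_sum_inner_eq {ι κ : Type*} [Fintype ι] [DecidableEq ι] [Fintype κ]
    {M : Matrix κ ι ℂ} {c : ℝ≥0} (hM : Mᴴ * M = c • (1 : Matrix ι ι ℂ)) (x y : ι → H) :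
    c * ‖∑ i, ⟪x i, y i⟫_ℂ‖ₑ = ‖∑ k, ⟪∑ i, M k i • x i, ∑ i, M k i • y i⟫_ℂ‖ₑ := by
  rw [sum_inner_sum_smul_sum_smul, hM]
  have hdiag : ∑ i, ∑ j, (c • (1 : Matrix ι ι ℂ)) i j * ⟪x i, y j⟫_ℂ
      = c • ∑ i, ⟪x i, y i⟫_ℂ := by
    simp [Matrix.one_apply, Finset.smul_sum]
  rw [hdiag, NNReal.smul_def, enorm_smul]
  simp

open scoped ComplexOrder in
theorem enorm_sum_of_nonneg {ι : Type*} (s : Finset ι) {z : ι → ℂ} (hz : ∀ i ∈ s, 0 ≤ z i) :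
    ‖∑ i ∈ s, z i‖ₑ = ∑ i ∈ s, ‖z i‖ₑ := by
  rw [enorm_eq_ofReal_re_of_nonneg (Finset.sum_nonneg hz), Complex.re_sum,
    ENNReal.ofReal_sum_of_nonneg fun i hi => (Complex.le_def.mp (hz i hi)).1]
  exact Finset.sum_congr rfl fun i hi => (enorm_eq_ofReal_re_of_nonneg (hz i hi)).symm

variable [CompleteSpace H]

theorem mul_sum_schattenNorm_rpow_le {ι κ : Type*} [Fintype ι] [DecidableEq ι] [Fintype κ]
    {M : Matrix κ ι ℂ} {c : ℝ≥0} (hM : Mᴴ * M = c • (1 : Matrix ι ι ℂ)) {p q : ℝ}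
    (hpq : p.HolderConjugate q) (hq : 2 ≤ q) (φ : ι → (H →L[ℂ] H)) :
    c * ∑ i, schattenNorm q (φ i) ^ q
      ≤ ∑ k, schattenNorm p (∑ i, M k i • schattenDual q (φ i))
          * schattenNorm q (∑ i, M k i • φ i) := by
  obtain ⟨w, e, _⟩ := exists_hilbertBasis ℂ H
  let ψ : ι → (H →L[ℂ] H) := fun i => schattenDual q (φ i)
  calc c * ∑ i, schattenNorm q (φ i) ^ q
      = c * ∑ i, ∑' l, ‖⟪ψ i (e l), φ i (e l)⟫_ℂ‖ₑ := by
        simp only [ψ, tsum_enorm_inner_schattenDual hq]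
    _ = ∑' l, c * ‖∑ i, ⟪ψ i (e l), φ i (e l)⟫_ℂ‖ₑ := by
        rw [← Summable.tsum_finsetSum fun _ _ => ENNReal.summable, ← ENNReal.tsum_mul_left]
        refine tsum_congr fun l => ?_
        rw [enorm_sum_of_nonneg _ fun i _ => inner_schattenDual_apply_nonneg hq (φ i) (e l)]
    _ = ∑' l, ‖∑ k, ⟪(∑ i, M k i • ψ i) (e l), (∑ i, M k i • φ i) (e l)⟫_ℂ‖ₑ := by
        simp only [mul_enorm_sum_inner_eq hM, sum_apply, smul_apply]
    _ ≤ ∑' l, ∑ k, ‖⟪(∑ i, M k i • ψ i) (e l), (∑ i, M k i • φ i) (e l)⟫_ℂ‖ₑ :=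
        ENNReal.tsum_le_tsum fun l => enorm_sum_le _ _
    _ = ∑ k, ∑' l, ‖⟪(∑ i, M k i • ψ i) (e l), (∑ i, M k i • φ i) (e l)⟫_ℂ‖ₑ :=
        Summable.tsum_finsetSum fun _ _ => ENNReal.summable
    _ ≤ ∑ k, schattenNorm p (∑ i, M k i • ψ i) * schattenNorm q (∑ i, M k i • φ i) :=
        Finset.sum_le_sum fun k _ => tsum_enorm_inner_apply_le_schattenNorm_mul hpq _ _ e

theorem theorem2p3_general {ι κ : Type*} [Fintype ι] [DecidableEq ι] [Fintype κ]
    {M : Matrix κ ι ℂ} {c : ℝ≥0} (hM : Mᴴ * M = c • (1 : Matrix ι ι ℂ)) {p q : ℝ}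
    (hpq : p.HolderConjugate q) (hp2 : p ≤ 2)
    (h : ∀ x : ι → (H →L[ℂ] H), (∀ i, x i ∈ schattenClass H p) →
      ∑ k, schattenNorm p (∑ i, M k i • x i) ^ q ≤ c * (∑ i, schattenNorm p (x i) ^ p) ^ (q / p))
    (φ : ι → (H →L[ℂ] H)) (hφ : ∀ i, φ i ∈ schattenClass H q) :
    c * (∑ i, schattenNorm q (φ i) ^ q) ^ (p / q)
      ≤ ∑ k, schattenNorm q (∑ i, M k i • φ i) ^ p := by
  have hp := hpq.pos
  have hq := hpq.symm.pos
  have hq2 : 2 ≤ q := by nlinarith [hpq.mul_eq_add, hpq.lt]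
  have hfin (i : ι) : schattenNorm q (φ i) ^ q ≠ ∞ := ENNReal.rpow_ne_top_of_nonneg hq.le (hφ i).ne
  let ψ : ι → (H →L[ℂ] H) := fun i => schattenDual q (φ i)
  have hψ (i : ι) : schattenNorm p (ψ i) ^ p = schattenNorm q (φ i) ^ q :=
    schattenNorm_schattenDual_rpow hpq hq2 (φ i)
  have hψmem (i : ι) : ψ i ∈ schattenClass H p :=
    (ENNReal.rpow_lt_top_iff_of_pos hp).mp ((hψ i).trans_lt (hfin i).lt_top)
  refine ennreal_mul_rpow_le_of_mul_le_rpow_mul_rpow hpq ENNReal.coe_ne_top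
    (ENNReal.sum_ne_top.mpr fun i _ => hfin i) ?_
  calc c * ∑ i, schattenNorm q (φ i) ^ q
      ≤ ∑ k, schattenNorm p (∑ i, M k i • ψ i) * schattenNorm q (∑ i, M k i • φ i) :=
        mul_sum_schattenNorm_rpow_le hM hpq hq2 φ
    _ ≤ (∑ k, schattenNorm p (∑ i, M k i • ψ i) ^ q) ^ (1 / q)
          * (∑ k, schattenNorm q (∑ i, M k i • φ i) ^ p) ^ (1 / p) :=
        ENNReal.inner_le_Lp_mul_Lq _ _ _ hpq.symm
    _ ≤ (c * (∑ i, schattenNorm q (φ i) ^ q) ^ (q / p)) ^ (1 / q)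
          * (∑ k, schattenNorm q (∑ i, M k i • φ i) ^ p) ^ (1 / p) := by
        gcongr
        simpa only [hψ] using h ψ hψmem

end Matrix

section SumDiff

open scoped Matrix

/-- The matrix that sends a family `x` indexed by `Fin n` to the family of its sum (row `none`) and
its differences `x i - x j` for `i < j` (row `⟨i, j⟩`). -/
def sumDiffMatrix (n : ℕ) : Matrix (Option (Σ i : Fin n, Finset.Ioi i)) (Fin n) ℂ :=
  fun k => k.elim 1 fun a => Pi.single a.1 1 - Pi.single (a.2 : Fin n) 1

theorem sum_sumDiffMatrix_smul {n : ℕ} {V N : Type*} [AddCommGroup V] [Module ℂ V]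
    [AddCommMonoid N] (x : Fin n → V) (F : V → N) :
    ∑ k, F (∑ i, sumDiffMatrix n k i • x i)
      = F (∑ i, x i) + ∑ i, ∑ j ∈ Finset.Ioi i, F (x i - x j) := by
  have hrow (i j : Fin n) :
      ∑ l, (Pi.single i 1 - Pi.single j 1 : Fin n → ℂ) l • x l = x i - x j := by
    simp [sub_smul, Pi.single_apply, Finset.sum_sub_distrib]
  simp only [Fintype.sum_option, Fintype.sum_sigma, sumDiffMatrix, Option.elim_none,
    Option.elim_some, Pi.one_apply, one_smul, hrow]
  congr 1
  exact Finset.sum_congr rfl fun i _ => Finset.sum_coe_sort (Finset.Ioi i) fun j => F (x i - x j)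

theorem sum_sum_eq_two_nsmul_sum_sum_Ioi {N : Type*} [AddCommMonoid N] {n : ℕ}
    {g : Fin n → Fin n → N} (hsymm : ∀ i j, g i j = g j i) (hdiag : ∀ i, g i i = 0) :
    ∑ i, ∑ j, g i j = 2 • ∑ i, ∑ j ∈ Finset.Ioi i, g i j := by
  have h := Finset.sum_sum_Ioi_add_eq_sum_sum_off_diag g
  simp only [hsymm, ← two_nsmul] at h
  simp only [Finset.smul_sum]
  rw [h]
  refine Finset.sum_congr rfl fun i _ => ?_
  rw [Fintype.sum_eq_add_sum_compl i, hdiag, zero_add]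

theorem sumDiffMatrix_conjTranspose_mul_self (n : ℕ) :
    (sumDiffMatrix n)ᴴ * sumDiffMatrix n = (n : NNReal) • (1 : Matrix (Fin n) (Fin n) ℂ) := by
  ext i j
  let d (a b : Fin n) : Fin n → ℂ := Pi.single a 1 - Pi.single b 1
  have hstar (a b l : Fin n) : star (d a b l) = d a b l := by
    simp only [d, Pi.sub_apply, Pi.single_apply]
    split_ifs <;> simp
  have hentry : ((sumDiffMatrix n)ᴴ * sumDiffMatrix n) i j
      = 1 + ∑ a, ∑ b ∈ Finset.Ioi a, d a b i * d a b j := by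
    rw [Matrix.mul_apply, Fintype.sum_option, Fintype.sum_sigma]
    congr 1
    · simp [sumDiffMatrix]
    · refine Finset.sum_congr rfl fun a _ => ?_
      rw [← Finset.sum_coe_sort (Finset.Ioi a) fun b => d a b i * d a b j]
      exact Finset.sum_congr rfl fun b _ => congrArg (· * d a b j) (hstar a b i)
  have hfull : ∑ a, ∑ b, d a b i * d a b j
      = 2 * (n * (1 : Matrix (Fin n) (Fin n) ℂ) i j - 1) := by
    simp only [d, Pi.sub_apply, Pi.single_apply, mul_sub, Finset.sum_sub_distrib,
      Matrix.one_apply]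
    split_ifs <;> simp [*] <;> ring
  have hhalf : ∑ a, ∑ b, d a b i * d a b j = 2 • ∑ a, ∑ b ∈ Finset.Ioi a, d a b i * d a b j :=
    sum_sum_eq_two_nsmul_sum_sum_Ioi (fun a b => by simp only [d, Pi.sub_apply]; ring)
      fun a => by simp [d]
  rw [hentry, Matrix.smul_apply, NNReal.smul_def, NNReal.coe_natCast, Complex.real_smul,
    Complex.ofReal_natCast]
  linear_combination (hfull - hhalf) / 2

end SumDiff

theorem theorem2p3 {H : Type*} [NormedAddCommGroup H] [InnerProductSpace ℂ H] [CompleteSpace H]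
    [TopologicalSpace.SeparableSpace H] (n : ℕ) (p q : ℝ) (hp1 : 1 < p) (hp2 : p ≤ 2)
    (hpq : 1 / p + 1 / q = 1)
    (h : ∀ x : Fin n → (H →L[ℂ] H), (∀ i, x i ∈ schattenClass H p) →
      schattenNorm p (∑ i, x i) ^ q
          + ∑ i, ∑ j ∈ Finset.Ioi i, schattenNorm p (x i - x j) ^ q
        ≤ (n : ℝ≥0∞) * (∑ i, schattenNorm p (x i) ^ p) ^ (q / p)) :
    ∀ φ : Fin n → (H →L[ℂ] H), (∀ i, φ i ∈ schattenClass H q) →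
      (n : ℝ≥0∞) * (∑ i, schattenNorm q (φ i) ^ q) ^ (p / q)
        ≤ schattenNorm q (∑ i, φ i) ^ p
          + ∑ i, ∑ j ∈ Finset.Ioi i, schattenNorm q (φ i - φ j) ^ p := by
  have hc : p.HolderConjugate q :=
    Real.holderConjugate_iff.mpr ⟨hp1, by simpa only [one_div] using hpq⟩
  have hM := sumDiffMatrix_conjTranspose_mul_self n
  simpa only [sum_sumDiffMatrix_smul _ fun X : H →L[ℂ] H => schattenNorm q X ^ p,
    ENNReal.coe_natCast] using theorem2p3_general (H := H) hM hc hp2 (by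
      simpa only [sum_sumDiffMatrix_smul _ fun X : H →L[ℂ] H => schattenNorm p X ^ q,
        ENNReal.coe_natCast] using h)
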